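/- Let $k$ be a quadratic number field whose discriminant factors as $d = d_1d_2d_3$, where each $d_i$ is a prime discriminant, i.e. $d_i \in \{-4, 8, -8\}$ or $d_i = \pm p$ for an odd prime $p$, with the sign chosen so that $d_i \equiv 1 \pmod 4$. Call a finite Galois extension $M/k$ an unramified $H_8$-extension if $\operatorname{Gal}(M/k)$ is isomorphic to the quaternion group $H_8$ of order $8$ and no finite prime ramifies in $M/k$ (ramification at the infinite places is allowed). Then $k$ has at most one unramified $H_8$-extension: if $M$ and $N$ are unramified $H_8$-extensions of $k$ contained in a common extension field $\Omega$ of $k$ (for example, a fixed algebraic closure of $k$), then $M = N$. -/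

import Mathlib

open scoped NumberField

/-- A prime discriminant: the discriminant of a quadratic number field in which exactly one
rational prime ramifies, that is `-4`, `8`, `-8`, or `±p` with `p` an odd prime and the sign
chosen such that `±p ≡ 1 (mod 4)`. -/
def IsPrimeDiscriminant (d : ℤ) : Prop :=
  d = -4 ∨ d = 8 ∨ d = -8 ∨ (d.natAbs.Prime ∧ d ≡ 1 [ZMOD 4])

/-- `M/k` is unramified at all finite primes (no condition at the infinite places). -/
def IsUnramifiedOutsideInfinity (k M : Type*) [Field k] [Field M] [Algebra k M] : Prop :=
  ∀ (P : Ideal (𝓞 M)) (_ : P.IsMaximal), Algebra.IsUnramifiedAt (𝓞 k) P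

/-- `M/k` is an unramified `H₈`-extension: a finite Galois extension, unramified at all finite
primes, whose Galois group is isomorphic to the quaternion group of order `8`
(`QuaternionGroup n` has order `4 * n`). It is not required to be normal over `ℚ`. -/
structure IsUnramifiedH8Extension (k M : Type*) [Field k] [Field M] [Algebra k M] : Prop where
  finiteDimensional : FiniteDimensional k M
  isGalois : IsGalois k M
  galois_group : Nonempty (Gal(M/k) ≃* QuaternionGroup 2)
  unramified : IsUnramifiedOutsideInfinity k M

/-! Embed `M` and `N` in a number field `F` Galois over ℚ, and let `G = Gal(F/ℚ)` and `A =
Gal(F/k)`, of index 2. By Minkowski, inertia elements generate `G`; those in `A` act trivially on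
`M` and `N`, which are unramified over `k`. Let `C` be the largest normal subgroup of `G` inside the
part of `A` fixing both fields. In `G/C` every inertia group has order at most 2 and meets `A/C`
trivially, and up to conjugacy the nontrivial ones come from the three `dᵢ`.

`G/C` is a 2-group, where generation may be tested up to conjugacy because maximal subgroups are
normal. So three involutions `x, y, z` outside `A/C` generate `G/C`, and `xy, yz` generate `A/C`. A
surjection onto `H₈` sends two generators to a non-commuting pair, and `Aut H₈` permutes such pairs
transitively, so two surjections from a two-generator group have the same kernel. Galois theory then
gives `M = N`. -/

/-! ### Surjections onto the quaternion group -/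

/-- The homomorphism from the quaternion group of order `8` with `a 1 ↦ x` and `xa 0 ↦ y`,
for a non-commuting pair `x, y`. -/
def QuaternionGroup.ofPairFun (x y : QuaternionGroup 2) : QuaternionGroup 2 → QuaternionGroup 2
  | .a i => x ^ i.val
  | .xa i => y * x ^ i.val

-- Non-commuting `x, y` have order 4 and satisfy `x² = y²` and `yxy⁻¹ = x⁻¹`, the defining relations
-- of the group.
set_option maxRecDepth 100000 in
set_option maxHeartbeats 4000000 in
theorem QuaternionGroup.ofPairFun_mul : ∀ x y : QuaternionGroup 2, x * y ≠ y * x →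
    ∀ g h, ofPairFun x y (g * h) = ofPairFun x y g * ofPairFun x y h := by
  decide

set_option maxRecDepth 100000 in
set_option maxHeartbeats 4000000 in
theorem QuaternionGroup.ofPairFun_eq_one : ∀ x y : QuaternionGroup 2, x * y ≠ y * x →
    ∀ g, ofPairFun x y g = 1 → g = 1 := by
  decide

theorem QuaternionGroup.exists_injective_hom {x y : QuaternionGroup 2} (h : x * y ≠ y * x) :
    ∃ θ : QuaternionGroup 2 →* QuaternionGroup 2, (∀ g, θ g = 1 → g = 1) ∧
      θ (.a 1) = x ∧ θ (.xa 0) = y :=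
  ⟨MonoidHom.mk' (ofPairFun x y) (ofPairFun_mul x y h), ofPairFun_eq_one x y h,
    pow_one x, mul_one y⟩

theorem QuaternionGroup.pow_four_eq_one : ∀ x : QuaternionGroup 2, x ^ 4 = 1 := by
  decide

/-- A surjection onto the quaternion group sends any two generators to a non-commuting pair. -/
theorem QuaternionGroup.map_not_commute {A : Type*} [Group A] {φ : A →* QuaternionGroup 2}
    (hφ : Function.Surjective φ) {u v : A}
    (h : ∀ a, ∃ b ∈ Subgroup.closure {u, v}, φ a = φ b) : φ u * φ v ≠ φ v * φ u := by
  intro hc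
  have hcl : ∀ a, φ a ∈ Subgroup.closure {φ u, φ v} := fun a ↦ by
    obtain ⟨b, hb, e⟩ := h a
    rw [e]
    have := Subgroup.mem_map_of_mem φ hb
    rwa [MonoidHom.map_closure, Set.image_pair] at this
  have hcomm : ∀ x ∈ ({φ u, φ v} : Set (QuaternionGroup 2)), ∀ y ∈ ({φ u, φ v} : Set _),
      x * y = y * x := by
    rintro x (rfl | rfl) y (rfl | rfl) <;> simp [hc]
  have := Subgroup.isMulCommutative_closure hcomm
  obtain ⟨p, hp⟩ := hφ (.a 1)
  obtain ⟨q, hq⟩ := hφ (.xa 0)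
  have := congrArg Subtype.val (mul_comm' (⟨_, hcl p⟩ : Subgroup.closure {φ u, φ v}) ⟨_, hcl q⟩)
  simp only [Subgroup.coe_mul, hp, hq] at this
  revert this
  decide

/-- Two surjections `φ`, `ψ` of a group onto the quaternion group of order `8` have the same kernel
if two elements generate the group modulo `φ.ker ⊓ ψ.ker`. -/
theorem QuaternionGroup.ker_le_ker_of_two_generators {A : Type*} [Group A]
    {φ ψ : A →* QuaternionGroup 2} (hφ : Function.Surjective φ) (hψ : Function.Surjective ψ)
    {u v : A} (h : ∀ a, ∃ b ∈ Subgroup.closure {u, v}, φ a = φ b ∧ ψ a = ψ b) :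
    φ.ker ≤ ψ.ker := by
  obtain ⟨θ, hθ, hθu, hθv⟩ := exists_injective_hom
    (map_not_commute hφ fun a ↦ (h a).imp fun b hb ↦ ⟨hb.1, hb.2.1⟩)
  obtain ⟨η, -, hηu, hηv⟩ := exists_injective_hom
    (map_not_commute hψ fun a ↦ (h a).imp fun b hb ↦ ⟨hb.1, hb.2.2⟩)
  -- On words in `u, v` the pair `(φ, ψ)` takes values in `{(θ g, η g)}`; as `θ` is injective, the
  -- first coordinate determines the second.
  have key : Subgroup.closure {u, v} ≤ (θ.prod η).range.comap (φ.prod ψ) := by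
    rw [Subgroup.closure_le]
    rintro x (rfl | rfl)
    · exact ⟨.a 1, by simp [hθu, hηu]⟩
    · exact ⟨.xa 0, by simp [hθv, hηv]⟩
  intro a ha
  obtain ⟨b, hb, h1, h2⟩ := h a
  obtain ⟨g, hg⟩ := key hb
  simp only [MonoidHom.prod_apply, Prod.mk.injEq] at hg
  rw [MonoidHom.mem_ker] at ha ⊢
  have : g = 1 := hθ g (by rw [hg.1, ← h1, ha])
  rw [h2, ← hg.2, this, map_one]

/-! ### Generation modulo a normal subgroup -/

/-- In a group that is nilpotent modulo a normal subgroup `C`, a subgroup containing `C` is the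
whole group if no proper normal subgroup contains it. -/
theorem Subgroup.eq_top_of_isNilpotent_quotient {G : Type*} [Group G] [Finite G]
    {C H : Subgroup G} [C.Normal] [Group.IsNilpotent (G ⧸ C)] (hC : C ≤ H)
    (h : ∀ K : Subgroup G, K.Normal → H ≤ K → K = ⊤) : H = ⊤ := by
  have hmap : H.map (QuotientGroup.mk' C) = ⊤ := by
    by_contra hne
    obtain ⟨K, hK, hle⟩ := (eq_top_or_exists_le_coatom (H.map (QuotientGroup.mk' C))).resolve_left
      hne
    have hKn : K.Normal :=
      NormalizerCondition.normal_of_coatom K Group.normalizerCondition_of_isNilpotent hK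
    have := h (K.comap (QuotientGroup.mk' C)) inferInstance (Subgroup.map_le_iff_le_comap.mp hle)
    apply hK.1
    rw [← Subgroup.map_comap_eq_self_of_surjective (QuotientGroup.mk'_surjective C) K, this,
      ← MonoidHom.range_eq_map, MonoidHom.range_eq_top.mpr (QuotientGroup.mk'_surjective C)]
  have := congrArg (Subgroup.comap (QuotientGroup.mk' C)) hmap
  rwa [Subgroup.comap_map_eq, QuotientGroup.ker_mk', sup_eq_left.mpr hC, Subgroup.comap_top] at this

/-- If `x`, `y`, `z` are involutions modulo a normal subgroup `C` and generate `G` modulo `C`,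
then the even words `x * y` and `y * z` generate modulo `C` a subgroup `B` with `G = B ∪ y⁻¹B`. -/
theorem Subgroup.mem_or_mul_mem_of_closure_sup_eq_top {G : Type*} [Group G] [Finite G]
    {C : Subgroup G} [hn : C.Normal] {x y z : G} (hx : x * x ∈ C) (hy : y * y ∈ C)
    (hz : z * z ∈ C) (h : Subgroup.closure {x, y, z} ⊔ C = ⊤) (g : G) :
    g ∈ Subgroup.closure {x * y, y * z} ⊔ C ∨ y * g ∈ Subgroup.closure {x * y, y * z} ⊔ C := by
  set B := Subgroup.closure {x * y, y * z} ⊔ C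
  have hCB : ∀ c ∈ C, c ∈ B := fun c hc ↦ (le_sup_right : C ≤ B) hc
  have hxy : x * y ∈ B := (le_sup_left : _ ≤ B) (Subgroup.subset_closure (by simp))
  have hyz : y * z ∈ B := (le_sup_left : _ ≤ B) (Subgroup.subset_closure (by simp))
  have hyx : y * x ∈ B := by
    have := B.mul_mem (B.mul_mem (hCB _ hy) (B.inv_mem hxy)) (hCB _ (hn.conj_mem _ hx x))
    convert this using 1
    group
  have hzy : z⁻¹ * y ∈ B := by
    have := B.mul_mem (B.inv_mem hyz) (hCB _ hy)
    convert this using 1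
    group
  -- Finiteness of `G` makes inverses superfluous, so the induction only multiplies by generators.
  have hgen : g ∈ Submonoid.closure ({x, y, z} ∪ (C : Set G)) := by
    have : g ∈ Subgroup.closure ({x, y, z} ∪ (C : Set G)) := by
      rw [Subgroup.closure_union, Subgroup.closure_eq, h]; trivial
    rwa [← Subgroup.mem_toSubmonoid, Subgroup.closure_toSubmonoid_of_finite] at this
  induction hgen using Submonoid.closure_induction_left with
  | one => exact .inl B.one_mem
  | mul_left s hs b _ ih =>
    rcases hs with (rfl | rfl | rfl) | hs
    · rcases ih with ih | ih
      · right
        rw [← mul_assoc]; exact B.mul_mem hyx ih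
      · left
        have := B.mul_mem (B.mul_mem hxy (B.inv_mem (hCB _ hy))) ih
        convert this using 1
        group
    · rcases ih with ih | ih
      · right
        rw [← mul_assoc]; exact B.mul_mem (hCB _ hy) ih
      · exact .inl ih
    · rcases ih with ih | ih
      · right
        rw [← mul_assoc]; exact B.mul_mem hyz ih
      · left
        have := B.mul_mem (B.mul_mem (B.mul_mem (hCB _ hz) hzy) (B.inv_mem (hCB _ hy))) ih
        convert this using 1
        group
    · rcases ih with ih | ih
      · exact .inl (B.mul_mem (hCB _ hs) ih)
      · right
        have := B.mul_mem (hCB _ (hn.conj_mem _ hs y)) ih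
        convert this using 1
        group

/-- Let `A` be a subgroup of index `2` of a finite group `G` generated by a set `T`, stable under
conjugation and squaring, which up to conjugation and elements of `A` is covered by three
subgroups. Then any two surjections from `A` to the quaternion group of order `8` that are trivial
on `T ∩ A` have the same kernel. -/
theorem QuaternionGroup.ker_le_ker_of_index_two {G A : Type*} [Group G] [Finite G] [Group A]
    {ι : A →* G} (hι : Function.Injective ι) (hidx : ι.range.index = 2)
    {φ ψ : A →* QuaternionGroup 2} (hφ : Function.Surjective φ) (hψ : Function.Surjective ψ)
    {T : Set G} (hT : Subgroup.closure T = ⊤) (hconj : ∀ g, ∀ τ ∈ T, g * τ * g⁻¹ ∈ T)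
    (hsq : ∀ τ ∈ T, τ * τ ∈ T) (hker : ∀ a, ι a ∈ T → φ a = 1 ∧ ψ a = 1)
    (J : Fin 3 → Subgroup G) (hJT : ∀ j, (J j : Set G) ⊆ T)
    (hJ : ∀ τ ∈ T, τ ∈ ι.range ∨ ∃ j g, g * τ * g⁻¹ ∈ J j) : φ.ker ≤ ψ.ker := by
  have hrn : ι.range.Normal := Subgroup.normal_of_index_eq_two hidx
  set C := ((φ.ker ⊓ ψ.ker).map ι).normalCore
  have hCker : ∀ c ∈ C, ∃ a, ι a = c ∧ φ a = 1 ∧ ψ a = 1 := fun c hc ↦ by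
    obtain ⟨a, ha, rfl⟩ := Subgroup.normalCore_le _ hc
    exact ⟨a, rfl, ha⟩
  have hTC : ∀ τ ∈ T, τ ∈ ι.range → τ ∈ C := fun τ hτ hr g ↦ by
    obtain ⟨b, hb⟩ := hrn.conj_mem _ hr g
    rw [← hb]
    exact Subgroup.mem_map_of_mem ι (hker b (hb ▸ hconj g τ hτ))
  have hnil : Group.IsNilpotent (G ⧸ C) := by
    have : Fact (Nat.Prime 2) := ⟨Nat.prime_two⟩
    -- Exponent 8 = 2 · 4: squares lie in the index 2 subgroup, and `H₈` has exponent 4.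
    refine IsPGroup.isNilpotent (p := 2) fun q ↦ ⟨3, ?_⟩
    obtain ⟨g, rfl⟩ := QuotientGroup.mk_surjective q
    rw [← QuotientGroup.mk_pow, QuotientGroup.eq_one_iff]
    intro b
    obtain ⟨a, ha⟩ := hrn.conj_mem _ (Subgroup.sq_mem_of_index_two hidx g) b
    have : b * g ^ 2 ^ 3 * b⁻¹ = ι (a ^ 4) := by
      rw [map_pow, ha, conj_pow, ← pow_mul]; rfl
    rw [this]
    exact Subgroup.mem_map_of_mem ι (by simp [MonoidHom.mem_ker, pow_four_eq_one])
  obtain ⟨s, hsT, hs⟩ : ∃ s ∈ T, s ∉ ι.range := by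
    by_contra! hall
    have : ι.range = ⊤ := top_le_iff.mp (hT ▸ (Subgroup.closure_le _).mpr hall)
    rw [this, Subgroup.index_top] at hidx
    exact absurd hidx (by decide)
  -- Two elements of `J j` outside `A` differ by an element of `T ∩ A`, hence of `C`, so one
  -- representative suffices. If `J j` lies in `A`, `s` is a harmless substitute.
  have hex : ∀ j, ∃ t ∈ T, t ∉ ι.range ∧ ∀ τ ∈ J j, τ ∈ C ∨ τ * t⁻¹ ∈ C := fun j ↦ by
    by_cases h : ∃ t ∈ J j, t ∉ ι.range
    · obtain ⟨t, ht, htr⟩ := h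
      refine ⟨t, hJT j ht, htr, fun τ hτ ↦ ?_⟩
      by_cases hr : τ ∈ ι.range
      · exact .inl (hTC τ (hJT j hτ) hr)
      · refine .inr (hTC _ (hJT j ((J j).mul_mem hτ ((J j).inv_mem ht))) ?_)
        rw [Subgroup.mul_mem_iff_of_index_two hidx, inv_mem_iff]
        exact iff_of_false hr htr
    · push Not at h
      exact ⟨s, hsT, hs, fun τ hτ ↦ .inl (hTC τ (hJT j hτ) (h τ hτ))⟩
  choose t htT htr htJ using hex
  have htt : ∀ j, t j * t j ∈ C := fun j ↦
    hTC _ (hsq _ (htT j)) (Subgroup.mul_self_mem_of_index_two hidx _)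
  have hgen : Subgroup.closure {t 0, t 1, t 2} ⊔ C = ⊤ := by
    refine Subgroup.eq_top_of_isNilpotent_quotient le_sup_right fun K hK hle ↦ ?_
    have hCK : C ≤ K := le_sup_right.trans hle
    have htK : ∀ j, t j ∈ K := fun j ↦ (le_sup_left.trans hle : _ ≤ K)
      (Subgroup.subset_closure (by fin_cases j <;> simp))
    refine top_le_iff.mp (hT ▸ (Subgroup.closure_le _).mpr fun τ hτ ↦ ?_)
    rcases hJ τ hτ with hr | ⟨j, g, hg⟩
    · exact hCK (hTC τ hτ hr)
    · have : g * τ * g⁻¹ ∈ K := by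
        rcases htJ j _ hg with h | h
        · exact hCK h
        · simpa using K.mul_mem (hCK h) (htK j)
      simpa [mul_assoc] using hK.conj_mem _ this g⁻¹
  have hmem : ∀ i j, t i * t j ∈ ι.range := fun i j ↦ by
    rw [Subgroup.mul_mem_iff_of_index_two hidx]
    exact iff_of_false (htr i) (htr j)
  obtain ⟨u, hu⟩ := hmem 0 1
  obtain ⟨v, hv⟩ := hmem 1 2
  refine ker_le_ker_of_two_generators hφ hψ (u := u) (v := v) fun a ↦ ?_
  have hcl : Subgroup.closure {t 0 * t 1, t 1 * t 2} = (Subgroup.closure {u, v}).map ι := by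
    rw [MonoidHom.map_closure, Set.image_pair, hu, hv]
  have hle : Subgroup.closure {t 0 * t 1, t 1 * t 2} ⊔ C ≤ ι.range :=
    sup_le (hcl ▸ Subgroup.map_le_range _ _) fun c hc ↦ by
      obtain ⟨a, ha, -⟩ := hCker c hc
      exact ⟨a, ha⟩
  have ha : ι a ∈ Subgroup.closure {t 0 * t 1, t 1 * t 2} ⊔ C := by
    refine (Subgroup.mem_or_mul_mem_of_closure_sup_eq_top (htt 0) (htt 1) (htt 2) hgen
      (ι a)).resolve_right fun h ↦ htr 1 ?_
    simpa using ι.range.mul_mem (hle h) (ι.range.inv_mem ⟨a, rfl⟩)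
  obtain ⟨b, hb, c, hc, hbc⟩ := Subgroup.mem_sup_of_normal_right.mp ha
  rw [hcl] at hb
  obtain ⟨b, hb, rfl⟩ := hb
  obtain ⟨c, rfl, hc1, hc2⟩ := hCker c hc
  rw [← map_mul] at hbc
  refine ⟨b, hb, ?_⟩
  rw [← hι hbc]
  simp [hc1, hc2]

/-! ### Inertia groups in number fields -/

/-- The inertia group of an unramified prime is trivial. -/
theorem Ideal.inertia_eq_bot_of_isUnramifiedAt {R S : Type*} (G : Type*) [CommRing R] [CommRing S]
    [Algebra R S] [Group G] [MulSemiringAction G S] [IsGaloisGroup G R S] [Finite G] [IsDomain R]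
    [IsDomain S] [Module.Finite R S] [Module.Flat R S] (P : Ideal S) [P.IsPrime]
    [PerfectField (P.under R).ResidueField] [Algebra.IsUnramifiedAt R P] : P.inertia G = ⊥ := by
  rw [← Subgroup.card_eq_one, card_inertia_eq_ramificationIdxIn (P.under R) P,
    ramificationIdxIn_eq_ramificationIdx (P.under R) P G, ramificationIdx_eq_one]

/-- Elements of an inertia group restrict to elements of the inertia group below. -/
theorem NumberField.restrictNormalHom_mem_inertia {K M F : Type*} [Field K] [Field M] [Field F]
    [Algebra K M] [Algebra K F] [Algebra M F] [IsScalarTower K M F] [Normal K M]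
    {P : Ideal (𝓞 F)} {σ : Gal(F/K)} (hσ : σ ∈ P.inertia Gal(F/K)) :
    AlgEquiv.restrictNormalHom M σ ∈ (P.under (𝓞 M)).inertia Gal(M/K) := by
  intro x
  have := hσ (algebraMap (𝓞 M) (𝓞 F) x)
  have e : σ • algebraMap (𝓞 M) (𝓞 F) x =
      algebraMap (𝓞 M) (𝓞 F) (AlgEquiv.restrictNormalHom M σ • x) := by
    apply RingOfIntegers.ext
    exact (AlgEquiv.restrictNormal_commutes σ M (x : M)).symm
  rw [e, ← map_sub] at this
  exact this

/-- Restriction to a normal subextension kills the inertia groups of primes that are unramified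
in the subextension. -/
theorem NumberField.restrictNormalHom_eq_one_of_mem_inertia {K M F : Type*} [Field K] [Field M]
    [Field F] [NumberField K] [NumberField M] [Algebra K M] [Algebra K F] [Algebra M F]
    [IsScalarTower K M F] [IsGalois K M] {P : Ideal (𝓞 F)} [P.IsPrime]
    (hP : Algebra.IsUnramifiedAt (𝓞 K) (P.under (𝓞 M))) {σ : Gal(F/K)}
    (hσ : σ ∈ P.inertia Gal(F/K)) : AlgEquiv.restrictNormalHom M σ = 1 := by
  have := restrictNormalHom_mem_inertia (M := M) hσ
  rwa [Ideal.inertia_eq_bot_of_isUnramifiedAt (R := 𝓞 K) Gal(M/K), Subgroup.mem_bot] at this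

/-- Restriction to a normal number field kills the inertia groups above the primes that do not
divide its discriminant. -/
theorem NumberField.restrictNormalHom_eq_one_of_not_dvd_discr {M F : Type*} [Field M]
    [Field F] [NumberField M] [NumberField F] [Algebra M F]
    [IsGalois ℚ M] {P : Ideal (𝓞 F)} [hP : P.IsMaximal] {p : ℤ} (hp : Prime p) (hpP : (p : 𝓞 F) ∈ P)
    (hd : ¬ p ∣ discr M) {σ : Gal(F/ℚ)}
    (hσ : σ ∈ P.inertia Gal(F/ℚ)) : AlgEquiv.restrictNormalHom M σ = 1 := by
  have hmem := restrictNormalHom_mem_inertia (M := M) hσ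
  have h1 : (P.under (𝓞 M)).IsMaximal := inferInstance
  have h2 := (not_dvd_discr_iff_forall_mem M (𝓞 M) hp).mp hd (P.under (𝓞 M)) inferInstance
    (by simpa [Ideal.mem_comap] using hpP)
  rwa [Ideal.inertia_eq_bot_of_isUnramifiedAt (R := ℤ) Gal(M/ℚ), Subgroup.mem_bot] at hmem

/-- The Galois group of a number field over `ℚ` is generated by its inertia groups. -/
theorem NumberField.eq_top_of_inertia_le {F : Type*} [Field F] [NumberField F] [IsGalois ℚ F]
    {H : Subgroup Gal(F/ℚ)} (hH : ∀ P : Ideal (𝓞 F), P.IsMaximal → P.inertia Gal(F/ℚ) ≤ H) :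
    H = ⊤ := by
  let E := IntermediateField.fixedField H
  suffices h : Module.finrank ℚ E = 1 by
    rw [← IntermediateField.fixingSubgroup_fixedField H,
      show IntermediateField.fixedField H = ⊥ from IntermediateField.finrank_eq_one_iff.mp h,
      IntermediateField.fixingSubgroup_bot]
  by_contra hE
  -- Minkowski: an extension of ℚ of degree greater than 1 ramifies somewhere. But inertia over ℚ
  -- lies in `H = Gal(F/E)`, so `F/ℚ` and `F/E` have equal ramification indices and `E/ℚ` is
  -- unramified.
  obtain ⟨𝔭, h𝔭, hram⟩ := exists_not_isUnramifiedAt_int (𝒪 := 𝓞 E) hE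
  apply hram
  obtain ⟨P, hP, hlies⟩ := Ideal.exists_maximal_ideal_liesOver_of_isIntegral (S := 𝓞 F) 𝔭
  have hI : Nat.card (P.inertia Gal(F/ℚ)) = Nat.card (P.inertia H) :=
    (Nat.card_congr (Subgroup.subgroupOfEquivOfLe (hH P hP)).toEquiv).symm
  have : IsGaloisGroup H E F := IsGaloisGroup.subgroup Gal(F/ℚ) ℚ F H
  have : IsGaloisGroup H (𝓞 E) (𝓞 F) := IsGaloisGroup.of_isFractionRing H (𝓞 E) (𝓞 F) E F
  rw [Ideal.card_inertia_eq_ramificationIdxIn (P.under ℤ) P,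
    Ideal.ramificationIdxIn_eq_ramificationIdx (P.under ℤ) P Gal(F/ℚ),
    Ideal.card_inertia_eq_ramificationIdxIn 𝔭 P,
    Ideal.ramificationIdxIn_eq_ramificationIdx 𝔭 P H] at hI
  rw [← Ideal.ramificationIdx_eq_one_iff]
  have htower := Ideal.ramificationIdx_tower (R := ℤ) 𝔭 P
  rw [hI] at htower
  exact (Nat.eq_of_mul_eq_mul_right (P.ramificationIdx_pos (𝓞 E)) (by rw [one_mul, ← htower])).symm

theorem IsPrimeDiscriminant.exists_prime {d : ℤ} (h : IsPrimeDiscriminant d) :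
    ∃ p : ℤ, Prime p ∧ ∀ q : ℤ, Prime q → q ∣ d → Associated q p := by
  rcases h with rfl | rfl | rfl | ⟨h, -⟩
  · refine ⟨2, Int.prime_two, fun q hq hd ↦ hq.associated_of_dvd Int.prime_two ?_⟩
    exact hq.dvd_of_dvd_pow (n := 2) (by rw [← dvd_neg]; exact hd)
  · refine ⟨2, Int.prime_two, fun q hq hd ↦ hq.associated_of_dvd Int.prime_two ?_⟩
    exact hq.dvd_of_dvd_pow (n := 3) hd
  · refine ⟨2, Int.prime_two, fun q hq hd ↦ hq.associated_of_dvd Int.prime_two ?_⟩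
    exact hq.dvd_of_dvd_pow (n := 3) (by rw [← dvd_neg]; exact hd)
  · have := Int.prime_iff_natAbs_prime.mpr h
    exact ⟨d, this, fun q hq hd ↦ hq.associated_of_dvd this hd⟩

open Pointwise in
theorem Ideal.conj_mem_inertia_smul {G R : Type*} [Group G] [Ring R] [MulSemiringAction G R]
    {P : Ideal R} {τ : G} (hτ : τ ∈ P.inertia G) (g : G) : g * τ * g⁻¹ ∈ (g • P).inertia G := by
  intro x
  have : (g * τ * g⁻¹) • x - x = g • (τ • (g⁻¹ • x) - g⁻¹ • x) := by
    simp [smul_sub, mul_smul]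
  rw [this]
  exact Ideal.smul_mem_pointwise_smul g _ P (hτ (g⁻¹ • x))

open Pointwise in
theorem Ideal.IsMaximal.smul {G R : Type*} [Group G] [CommRing R] [MulSemiringAction G R]
    {P : Ideal R} (hP : P.IsMaximal) (g : G) : (g • P).IsMaximal := by
  rw [Ideal.pointwise_smul_eq_comap]
  exact Ideal.comap_isMaximal_of_equiv _

theorem AlgEquiv.range_restrictScalarsHom_eq_ker {R K L : Type*} [Field R] [Field K] [Field L]
    [Algebra R K] [Algebra R L] [Algebra K L] [IsScalarTower R K L] [Normal R K] :
    (AlgEquiv.restrictScalarsHom R : Gal(L/K) →* Gal(L/R)).range =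
      (AlgEquiv.restrictNormalHom K : Gal(L/R) →* Gal(K/R)).ker := by
  ext σ
  constructor
  · rintro ⟨τ, rfl⟩
    rw [MonoidHom.mem_ker]
    ext x
    apply (algebraMap K L).injective
    exact (AlgEquiv.restrictNormal_commutes _ K x).trans (τ.commutes x)
  · intro hσ
    refine ⟨{ σ with commutes' := fun x ↦ ?_ }, by ext; rfl⟩
    have := AlgEquiv.restrictNormal_commutes σ K x
    rw [show σ.restrictNormal K = 1 from hσ] at this
    exact this.symm

/-- If the discriminant of a normal number field `k` is a product of prime discriminants, then up
to conjugation and elements fixing `k`, the inertia elements lie in one inertia group for each of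
the prime discriminants. -/
theorem NumberField.exists_inertia_conj {k F ι : Type*} [Field k] [NumberField k] [Field F]
    [NumberField F] [IsGalois ℚ F] [IsGalois ℚ k] [Algebra k F] [Fintype ι] (d : ι → ℤ)
    (hd : ∀ j, IsPrimeDiscriminant (d j)) (hdiscr : discr k = ∏ j, d j) :
    ∃ P : ι → Ideal (𝓞 F), (∀ j, (P j).IsMaximal) ∧
      ∀ Q : Ideal (𝓞 F), Q.IsMaximal → ∀ τ ∈ Q.inertia Gal(F/ℚ),
        AlgEquiv.restrictNormalHom k τ = 1 ∨ ∃ j g, g * τ * g⁻¹ ∈ (P j).inertia Gal(F/ℚ) := by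
  choose p hp hpd using fun j ↦ (hd j).exists_prime
  have hlies : ∀ j, ∃ P : Ideal (𝓞 F), P.IsMaximal ∧ P.LiesOver (Ideal.span {p j}) := fun j ↦ by
    have : (Ideal.span {p j}).IsMaximal :=
      PrincipalIdealRing.isMaximal_of_irreducible (hp j).irreducible
    exact Ideal.exists_maximal_ideal_liesOver_of_isIntegral (S := 𝓞 F) _
  choose P hPmax hPlies using hlies
  refine ⟨P, hPmax, fun Q hQ τ hτ ↦ ?_⟩
  obtain ⟨q, hq⟩ : ∃ q, Q.under ℤ = Ideal.span {q} :=
    (IsPrincipalIdealRing.principal (Q.under ℤ)).principal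
  have hq0 : q ≠ 0 := by
    rintro rfl
    exact Ideal.IsMaximal.ne_bot_of_isIntegral_int Q
      (Ideal.eq_bot_of_comap_eq_bot (hq.trans (by simp)))
  have hqp : Prime q := by
    rw [← Ideal.span_singleton_prime hq0, ← hq]
    infer_instance
  by_cases hqd : q ∣ discr k
  · right
    rw [hdiscr, hqp.dvd_finsetProd_iff] at hqd
    obtain ⟨j, -, hj⟩ := hqd
    have hQl : Q.LiesOver (Ideal.span {p j}) :=
      ⟨by rw [hq]; exact (Ideal.span_singleton_eq_span_singleton.mpr (hpd j q hqp hj)).symm⟩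
    have := hPmax j
    have := hPlies j
    -- `Q` and `P j` lie over the same rational prime, so they are conjugate.
    obtain ⟨g, hg⟩ := Ideal.exists_smul_eq_of_isGaloisGroup (Ideal.span {p j}) Q (P j) Gal(F/ℚ)
    exact ⟨j, g, hg ▸ Ideal.conj_mem_inertia_smul hτ g⟩
  · left
    refine restrictNormalHom_eq_one_of_not_dvd_discr hqp ?_ hqd hτ
    have : q ∈ Q.under ℤ := hq ▸ Ideal.mem_span_singleton_self q
    simpa [Ideal.mem_comap] using this

/-! ### Comparison of the two extensions -/

/-- In a Galois number field `F` containing a quadratic field `k` at most three primes of which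
ramify, the Galois group of `F` over an unramified `H₈`-extension of `k` is contained in that of `F` over any
other one. -/
theorem IsUnramifiedH8Extension.ker_restrictNormalHom_le {k F M N : Type*} [Field k] [NumberField k]
    [Field F] [NumberField F] [IsGalois ℚ F] [Algebra k F] [Field M] [Field N] [Algebra k M]
    [Algebra k N] [Algebra M F] [Algebra N F] [IsScalarTower k M F] [IsScalarTower k N F]
    [IsGalois k M] [IsGalois k N]
    (hk : Module.finrank ℚ k = 2) (d : Fin 3 → ℤ) (hd : ∀ j, IsPrimeDiscriminant (d j))
    (hdiscr : NumberField.discr k = ∏ j, d j)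
    (hM : IsUnramifiedH8Extension k M) (hN : IsUnramifiedH8Extension k N) :
    (AlgEquiv.restrictNormalHom M : Gal(F/k) →* Gal(M/k)).ker ≤
      (AlgEquiv.restrictNormalHom N : Gal(F/k) →* Gal(N/k)).ker := by
  have := hM.finiteDimensional
  have := hN.finiteDimensional
  have : NumberField M := NumberField.of_module_finite k M
  have : NumberField N := NumberField.of_module_finite k N
  obtain ⟨e⟩ := hM.galois_group
  obtain ⟨f⟩ := hN.galois_group
  have : IsGalois k F := IsGalois.tower_top_of_isGalois ℚ k F
  have : Algebra.IsQuadraticExtension ℚ k := { finrank_eq_two' := hk }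
  have : IsGalois ℚ k := inferInstance
  have hidx : (AlgEquiv.restrictScalarsHom ℚ : Gal(F/k) →* Gal(F/ℚ)).range.index = 2 := by
    rw [AlgEquiv.range_restrictScalarsHom_eq_ker, Subgroup.index_ker, MonoidHom.range_eq_top.mpr
      (AlgEquiv.restrictNormalHom_surjective F), Subgroup.card_top, IsGalois.card_aut_eq_finrank, hk]
  have hsurjM : Function.Surjective (e.toMonoidHom.comp
      (AlgEquiv.restrictNormalHom M : Gal(F/k) →* Gal(M/k))) :=
    e.surjective.comp (AlgEquiv.restrictNormalHom_surjective F)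
  have hsurjN : Function.Surjective (f.toMonoidHom.comp
      (AlgEquiv.restrictNormalHom N : Gal(F/k) →* Gal(N/k))) :=
    f.surjective.comp (AlgEquiv.restrictNormalHom_surjective F)
  obtain ⟨P, hPmax, hP⟩ := NumberField.exists_inertia_conj (F := F) d hd hdiscr
  have key := QuaternionGroup.ker_le_ker_of_index_two (AlgEquiv.restrictScalars_injective ℚ) hidx
    hsurjM hsurjN (T := {τ | ∃ Q : Ideal (𝓞 F), Q.IsMaximal ∧ τ ∈ Q.inertia Gal(F/ℚ)})
    ?_ ?_ ?_ ?_ (fun j ↦ (P j).inertia Gal(F/ℚ)) ?_ ?_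
  · intro σ hσ
    have hσ' : σ ∈ (e.toMonoidHom.comp
        (AlgEquiv.restrictNormalHom M : Gal(F/k) →* Gal(M/k))).ker := by
      rw [MonoidHom.mem_ker] at hσ ⊢
      rw [MonoidHom.comp_apply, hσ, map_one]
    exact f.injective ((key hσ').trans (map_one f).symm)
  · exact NumberField.eq_top_of_inertia_le fun Q hQ τ hτ ↦ Subgroup.subset_closure ⟨Q, hQ, hτ⟩
  · rintro g τ ⟨Q, hQ, hτ⟩
    exact ⟨_, hQ.smul g, Ideal.conj_mem_inertia_smul hτ g⟩
  · rintro τ ⟨Q, hQ, hτ⟩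
    exact ⟨Q, hQ, mul_mem hτ hτ⟩
  · rintro σ ⟨Q, hQ, hσ⟩
    have hσ' : σ ∈ Q.inertia Gal(F/k) := hσ
    rw [MonoidHom.comp_apply, MonoidHom.comp_apply,
      NumberField.restrictNormalHom_eq_one_of_mem_inertia (hM.unramified _ inferInstance) hσ',
      NumberField.restrictNormalHom_eq_one_of_mem_inertia (hN.unramified _ inferInstance) hσ']
    exact ⟨map_one e, map_one f⟩
  · exact fun j τ hτ ↦ ⟨P j, hPmax j, hτ⟩
  · rintro τ ⟨Q, hQ, hτ⟩
    rw [AlgEquiv.range_restrictScalarsHom_eq_ker]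
    exact hP Q hQ τ hτ

/-- An unramified `H₈`-extension of a quadratic field at most three primes of which ramify is
contained in any other one. -/
theorem IsUnramifiedH8Extension.le {k : Type*} [Field k] [NumberField k]
    (hk : Module.finrank ℚ k = 2) (d : Fin 3 → ℤ) (hd : ∀ j, IsPrimeDiscriminant (d j))
    (hdiscr : NumberField.discr k = ∏ j, d j) {Ω : Type*} [Field Ω] [Algebra k Ω]
    {M N : IntermediateField k Ω} (hM : IsUnramifiedH8Extension k M)
    (hN : IsUnramifiedH8Extension k N) : M ≤ N := by
  have := hM.finiteDimensional
  have := hN.finiteDimensional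
  have := hM.isGalois
  have := hN.isGalois
  let L := M ⊔ N
  have : NumberField L := NumberField.of_module_finite k L
  -- The closure is taken over ℚ, since `M` and `N` need not be normal over ℚ and the argument uses
  -- inertia in `Gal(F/ℚ)`.
  let F := IntermediateField.normalClosure ℚ L (AlgebraicClosure L)
  have : NumberField F := { to_charZero := inferInstance, to_finiteDimensional := inferInstance }
  have : Algebra.IsAlgebraic ℚ (AlgebraicClosure L) := Algebra.IsAlgebraic.trans ℚ L _
  have : IsAlgClosure ℚ (AlgebraicClosure L) := ⟨inferInstance, inferInstance⟩
  have : Normal ℚ (AlgebraicClosure L) := IsAlgClosure.normal ℚ _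
  have : IsGalois ℚ F := {
    to_isSeparable := inferInstance
    to_normal := normalClosure.normal ℚ L (AlgebraicClosure L) }
  let : Algebra k F := ((algebraMap L F).comp (algebraMap k L)).toAlgebra
  let fM : M →+* F := (algebraMap L F).comp (IntermediateField.inclusion le_sup_left).toRingHom
  let fN : N →+* F := (algebraMap L F).comp (IntermediateField.inclusion le_sup_right).toRingHom
  let : Algebra M F := fM.toAlgebra
  let : Algebra N F := fN.toAlgebra
  have : IsScalarTower k M F := .of_algebraMap_eq fun _ ↦ rfl
  have : IsScalarTower k N F := .of_algebraMap_eq fun _ ↦ rfl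
  have : NumberField N := NumberField.of_module_finite k N
  have : IsGalois N F := IsGalois.tower_top_of_isGalois ℚ N F
  have : FiniteDimensional N F := Module.Finite.of_restrictScalars_finite ℚ N F
  intro x hx
  have key : ∀ τ : Gal(F/N), τ (fM ⟨x, hx⟩) = fM ⟨x, hx⟩ := fun τ ↦ by
    have h1 : τ.restrictScalars k ∈ (AlgEquiv.restrictNormalHom N : Gal(F/k) →* Gal(N/k)).ker := by
      rw [MonoidHom.mem_ker]
      ext y
      apply congrArg
      apply (algebraMap N F).injective
      exact (AlgEquiv.restrictNormal_commutes _ N y).trans (τ.commutes y)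
    have h2 := ker_restrictNormalHom_le (F := F) hk d hd hdiscr hN hM h1
    have h3 := AlgEquiv.restrictNormal_commutes (τ.restrictScalars k) M ⟨x, hx⟩
    rw [show (τ.restrictScalars k).restrictNormal M = 1 from h2] at h3
    exact h3.symm
  obtain ⟨y, hy⟩ := (IsGalois.mem_bot_iff_fixed (F := N) (fM ⟨x, hx⟩)).mpr key
  have hxy : (y : Ω) = x := congrArg Subtype.val ((algebraMap L F).injective hy)
  exact hxy ▸ y.2

theorem mainTheorem7 {k : Type*} [Field k] [NumberField k]
    (hk : Module.finrank ℚ k = 2) (d₁ d₂ d₃ : ℤ)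
    (h₁ : IsPrimeDiscriminant d₁) (h₂ : IsPrimeDiscriminant d₂) (h₃ : IsPrimeDiscriminant d₃)
    (hd : NumberField.discr k = d₁ * d₂ * d₃)
    {Ω : Type*} [Field Ω] [Algebra k Ω] (M N : IntermediateField k Ω)
    (hM : IsUnramifiedH8Extension k M) (hN : IsUnramifiedH8Extension k N) :
    M = N := by
  have hdiscr : NumberField.discr k = ∏ j, ![d₁, d₂, d₃] j := by simp [Fin.prod_univ_three, hd]
  have hp : ∀ j, IsPrimeDiscriminant (![d₁, d₂, d₃] j) := by
    intro j
    fin_cases j <;> assumption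
  exact le_antisymm (hM.le hk _ hp hdiscr hN) (hN.le hk _ hp hdiscr hM)
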